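/- Work over $\mathbb{C}$. Let $n\ge 1$, let $Q=(q_0,\dots,q_n)$ be a tuple of positive integers, and put $d=\gcd(q_0,\dots,q_n)$ and $a_i=q_i/d$. The weighted projective stack of type $Q$ is the quotient stack $\mathbf{P}(Q)=[(\mathbb{A}^{n+1}\setminus\{0\})/\mathbb{G}_m]$ for the action $\lambda\cdot(x_0,\dots,x_n)=(\lambda^{q_0}x_0,\dots,\lambda^{q_n}x_n)$. A stacky fan with $m$ rays is a triple $\mathbf{\Sigma}=(N,\Sigma,\beta)$ of a finitely generated abelian group $N$, a simplicial fan $\Sigma$ in $N\otimes_{\mathbb{Z}}\mathbb{Q}$, and a homomorphism $\beta:\mathbb{Z}^m\to N$ with finite cokernel such that the images in $N\otimes\mathbb{Q}$ of $b_i=\beta(e_i)$ generate the rays $\rho_i$ of $\Sigma$, each ray being generated by exactly one of them. Choose a free resolution $0\to\mathbb{Z}^r\xrightarrow{R}\mathbb{Z}^s\to N\to 0$ and a lift $B:\mathbb{Z}^m\to\mathbb{Z}^s$ of $\beta$. Then $DG(\beta)$ is the cokernel of $[B\ R]^{\star}:(\mathbb{Z}^s)^{\star}\to(\mathbb{Z}^{m}\oplus\mathbb{Z}^{r})^{\star}$,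 and the Gale dual $\beta^\vee:(\mathbb{Z}^m)^\star\to DG(\beta)$ is induced by the inclusion $(\mathbb{Z}^m)^\star\to(\mathbb{Z}^{m}\oplus\mathbb{Z}^{r})^\star$. The toric Deligne–Mumford stack of $\mathbf{\Sigma}$ is $\mathcal{X}(\mathbf{\Sigma})=[Z/G]$, where $Z=\mathbb{A}^m\setminus V(J_\Sigma)$ with $J_\Sigma=\langle\prod_{\rho_i\not\subset\sigma}z_i:\sigma\in\Sigma\rangle$, and $G=\mathrm{Hom}(DG(\beta),\mathbb{G}_m)$ acts through the homomorphism $G\to\mathbb{G}_m^m$ dual to $\beta^\vee$. **Proposition.** Every weighted projective stack $\mathbf{P}(Q)$ is a toric Deligne–Mumford stack. More precisely: 1. There are vectors $v_0,\dots,v_n$ that generate $\mathbb{Z}^n$ and satisfy $\sum_i a_iv_i=0$, and there are $c_0,\dots,c_n\in\mathbb{Z}_d=\mathbb{Z}/d\mathbb{Z}$ such that $\sum_i a_ic_i$ is a unit of $\mathbb{Z}_d$. 2. For any such $v_i$ and $c_i$, let $N=\mathbb{Z}^n\oplus\mathbb{Z}_d$, let $\beta:\mathbb{Z}^{n+1}\to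 N$ be given by $\beta(e_i)=b_i=(v_i,c_i)$, and let $\Sigma$ be the set of cones in $N\otimes\mathbb{Q}$ generated by the images of the proper subsets of $\{b_0,\dots,b_n\}$. Then $\mathbf{\Sigma}=(N,\Sigma,\beta)$ is a stacky fan. For every choice of resolution and lift as above, there is an isomorphism $DG(\beta)\cong\mathbb{Z}$ under which $\beta^\vee:\mathbb{Z}^{n+1}\to\mathbb{Z}$ is given by the matrix $[q_0,\dots,q_n]$, and there is an isomorphism $\mathcal{X}(\mathbf{\Sigma})\cong\mathbf{P}(Q)$ of stacks over $\mathbb{C}$. -/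

import Mathlib

open CategoryTheory AlgebraicGeometry Limits MonoidalCategory CartesianMonoidalCategory MonObj
open scoped TensorProduct

noncomputable section

namespace ToricDM

/-! ### Stacky fans -/

section StackyFans

variable {N : Type} [AddCommGroup N]

/-- A (rational polyhedral) simplicial fan in `N ⊗ ℚ`: a finite nonempty set of simplicial cones,
closed under taking faces, any two of which meet in a common face. -/
structure IsSimplicialFan {V : Type} [AddCommGroup V] [Module ℚ V]
    (cones : Set (PointedCone ℚ V)) : Prop where
  finite : cones.Finite
  nonempty : cones.Nonempty
  simplicial : ∀ σ ∈ cones, σ.IsSimplicial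
  face_mem : ∀ σ ∈ cones, ∀ τ : PointedCone ℚ V, τ.IsFaceOf σ → τ ∈ cones
  inf_isFaceOf : ∀ σ ∈ cones, ∀ τ ∈ cones, (σ ⊓ τ).IsFaceOf σ ∧ (σ ⊓ τ).IsFaceOf τ

/-- The ray of `N ⊗ ℚ` spanned by the image of `b ∈ N` (only a cone `{0}` if `b` is torsion). -/
def rayOf (b : N) : PointedCone ℚ (ℚ ⊗[ℤ] N) :=
  PointedCone.hull ℚ {(1 : ℚ) ⊗ₜ[ℤ] b}

/-- A stacky fan `(N, Σ, β)` with `m` rays: a finitely generated abelian group `N`, a simplicial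
fan `Σ` in `N ⊗ ℚ` and a homomorphism `β : ℤ^m → N` with finite cokernel, such that the images of
`b_i = β e_i` in `N ⊗ ℚ` generate the rays of `Σ`, each ray being generated by exactly one `b_i`. -/
structure StackyFan (N : Type) [AddCommGroup N] (m : ℕ) where
  finite_lattice : Module.Finite ℤ N
  cones : Set (PointedCone ℚ (ℚ ⊗[ℤ] N))
  isSimplicialFan : IsSimplicialFan cones
  β : (Fin m → ℤ) →ₗ[ℤ] N
  finite_coker : Finite (N ⧸ LinearMap.range β)
  rays : Set.BijOn (fun i => rayOf (β (Pi.single i 1))) Set.univ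
    {ρ | ρ ∈ cones ∧ Module.finrank ℚ (Submodule.span ℚ (ρ : Set (ℚ ⊗[ℤ] N))) = 1}

/-! ### Gale duality -/

/-- The choices made in the construction of the Gale dual of `β : ℤ^m → N`: a free resolution
`0 → ℤ^r → ℤ^s → N → 0` and a lift `B : ℤ^m → ℤ^s` of `β`. -/
structure GaleData {m : ℕ} (β : (Fin m → ℤ) →ₗ[ℤ] N) where
  r : ℕ
  s : ℕ
  rel : (Fin r → ℤ) →ₗ[ℤ] (Fin s → ℤ)
  aug : (Fin s → ℤ) →ₗ[ℤ] N
  rel_injective : Function.Injective rel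
  exact : Function.Exact rel aug
  aug_surjective : Function.Surjective aug
  lift : (Fin m → ℤ) →ₗ[ℤ] (Fin s → ℤ)
  aug_comp_lift : aug ∘ₗ lift = β

/-- For a finitely generated `N` the choices can be made. -/
theorem GaleData.nonempty [Module.Finite ℤ N] {m : ℕ} (β : (Fin m → ℤ) →ₗ[ℤ] N) :
    Nonempty (GaleData β) := by
  obtain ⟨s, f, hf⟩ := Module.Finite.exists_fin' ℤ N
  obtain ⟨r, b⟩ := Submodule.basisOfPid (Pi.basisFun ℤ (Fin s)) (LinearMap.ker f)
  obtain ⟨B, hB⟩ := Module.projective_lifting_property f β hf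
  refine ⟨⟨r, s, (LinearMap.ker f).subtype ∘ₗ b.equivFun.symm.toLinearMap, f, ?_, ?_, hf, B, hB⟩⟩
  · exact (LinearMap.ker f).injective_subtype.comp b.equivFun.symm.injective
  · rw [LinearMap.exact_iff, LinearMap.range_comp, LinearEquiv.range, Submodule.map_top,
      Submodule.range_subtype]

namespace GaleData

variable {m : ℕ} {β : (Fin m → ℤ) →ₗ[ℤ] N} (D : GaleData β)

/-- The differential `[B Q] : ℤ^m ⊕ ℤ^r → ℤ^s` of the mapping cone of `β`. -/
def coneMap : (Fin m → ℤ) × (Fin D.r → ℤ) →ₗ[ℤ] (Fin D.s → ℤ) :=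
  D.lift.coprod D.rel

/-- `DG(β) = H¹(Cone(β)^⋆)`, the cokernel of the transpose of `[B Q]`. -/
abbrev DG : Type :=
  Module.Dual ℤ ((Fin m → ℤ) × (Fin D.r → ℤ)) ⧸ LinearMap.range D.coneMap.dualMap

/-- The Gale dual `β^∨ : (ℤ^m)^⋆ → DG(β)`, induced by `(ℤ^m)^⋆ → (ℤ^m ⊕ ℤ^r)^⋆`. -/
def dual : Module.Dual ℤ (Fin m → ℤ) →ₗ[ℤ] D.DG :=
  (LinearMap.range D.coneMap.dualMap).mkQ ∘ₗ (LinearMap.fst ℤ (Fin m → ℤ) (Fin D.r → ℤ)).dualMap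

/-- `β^∨` of the `i`-th element of the standard basis of `(ℤ^m)^⋆ = ℤ^m`. -/
def weight (i : Fin m) : D.DG := D.dual (LinearMap.proj i)

end GaleData

end StackyFans

/-! ### Group actions and quotient stacks over `ℂ` -/

/-- An action of a group object from an action on points. -/
@[reducible] def modObjOfPoints {C : Type*} [Category C] [CartesianMonoidalCategory C] {G X : C}
    [MonObj G] (a : G ⊗ X ⟶ X) (h1 : ∀ {Y : C} (x : Y ⟶ X), lift 1 x ≫ a = x)
    (h2 : ∀ {Y : C} (g h : Y ⟶ G) (x : Y ⟶ X),
      lift (g * h) x ≫ a = lift g (lift h x ≫ a) ≫ a) : ModObj G X where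
  smul := a
  one_smul := by
    have h : (η[G] ▷ X) = lift 1 (snd _ _) := by
      ext1
      · simp [Hom.one_def, toUnit_unique (fst (𝟙_ C) X) (toUnit _)]
      · simp
    change (η[G] ▷ X) ≫ a = (λ_ X).hom
    rw [h, h1, leftUnitor_hom]
  mul_smul := by
    have e1 : (MonObj.mul (X := G) ▷ X) =
        lift ((fst _ _ ≫ fst _ _) * (fst _ _ ≫ snd _ _)) (snd _ _) := by
      ext1
      · simp [Hom.mul_def, ← comp_lift]
      · simp
    have e2 : (α_ G G X).hom ≫ (G ◁ a) =
        lift (fst _ _ ≫ fst _ _) (lift (fst _ _ ≫ snd _ _) (snd _ _) ≫ a) := by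
      ext1
      · simp
      · simp only [Category.assoc, whiskerLeft_snd, lift_snd]
        rw [← Category.assoc]
        congr 1
        ext1 <;> simp
    change (MonObj.mul (X := G) ▷ X) ≫ a = (α_ G G X).hom ≫ (G ◁ a) ≫ a
    rw [e1, h2, ← e2, Category.assoc]

/-- The base scheme `Spec ℂ`. -/
abbrev SpecC : Scheme.{0} := Spec (CommRingCat.of ℂ)

/-- `Spec A` as a `ℂ`-scheme. -/
abbrev specOver (A : Type) [CommRing A] [Algebra ℂ A] : Over SpecC :=
  (Spec (CommRingCat.of A)).asOver SpecC

/-- The diagonalizable group scheme `D(M) = Hom(M, 𝔾_m) = Spec ℂ[M]`, with the group structure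
coming from the Hopf algebra `ℂ[M]`. In particular `D(ℤ) = 𝔾_m`. -/
abbrev diagGroup (M : Type) [AddCommGroup M] : Over SpecC := specOver (AddMonoidAlgebra ℂ M)

/-- Affine space `𝔸^m` over `ℂ`. -/
abbrev affineSpaceC (m : ℕ) : Over SpecC := specOver (MvPolynomial (Fin m) ℂ)

section
variable {A B : Type} [CommRing A] [Algebra ℂ A] [CommRing B] [Algebra ℂ B] {Y : Over SpecC}

/-- The ring homomorphism `A → Γ(Y)` given by a morphism `Y ⟶ Spec A`. -/
def comorphism (x : Y ⟶ specOver A) : A →+* Γ(Y.left, ⊤) :=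
  ((Scheme.ΓSpecIso (CommRingCat.of A)).inv ≫ x.left.appTop).hom

theorem comorphism_ext {x y : Y ⟶ specOver A} (h : comorphism x = comorphism y) : x = y := by
  ext1
  apply ext_to_Spec
  ext1
  exact h

theorem comorphism_specMap (x : Y ⟶ specOver A) (y : Y ⟶ specOver B) (φ : B →+* A)
    (h : y.left = x.left ≫ Spec.map (CommRingCat.ofHom φ)) (b : B) :
    comorphism y b = comorphism x (φ b) := by
  have := congrArg (fun f => x.left.appTop (f.hom b))
    (Scheme.ΓSpecIso_inv_naturality (CommRingCat.ofHom φ))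
  simp only [comorphism, h]
  exact this.symm

theorem comorphism_algebraMap (x : Y ⟶ specOver A) (c : ℂ) :
    comorphism x (algebraMap ℂ A c) = Y.hom.appTop ((Scheme.ΓSpecIso (CommRingCat.of ℂ)).inv c) := by
  have h := Over.w x
  have := congrArg (fun f => x.left.appTop (f.hom c))
    (Scheme.ΓSpecIso_inv_naturality (CommRingCat.ofHom (algebraMap ℂ A)))
  rw [← h]
  exact this

/-- The canonical map `Spec A × Spec B → Spec (A ⊗ B)`. -/
def prodIso : specOver A ⊗ specOver B ⟶ specOver (A ⊗[ℂ] B) :=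
  Over.homMk (pullbackSpecIso ℂ A B).hom (pullbackSpecIso_hom_base ℂ A B)

theorem comorphism_lift (g : Y ⟶ specOver A) (x : Y ⟶ specOver B) (a : A) (b : B) :
    comorphism (lift g x ≫ prodIso) (a ⊗ₜ b) = comorphism g a * comorphism x b := by
  have h1 := comorphism_specMap (lift g x ≫ prodIso) g
    (Algebra.TensorProduct.includeLeftRingHom (R := ℂ) (A := A) (B := B)) (by
      have := pullbackSpecIso_hom_fst ℂ A B
      refine (pullback.lift_fst _ _ ((Over.w g).trans (Over.w x).symm)).symm.trans ?_
      exact (congrArg (fun f => (lift g x).left ≫ f) this).symm) a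
  have h2 := comorphism_specMap (lift g x ≫ prodIso) x
    (RingHomClass.toRingHom (Algebra.TensorProduct.includeRight (R := ℂ) (A := A) (B := B))) (by
      have := pullbackSpecIso_hom_snd ℂ A B
      refine (pullback.lift_snd _ _ ((Over.w g).trans (Over.w x).symm)).symm.trans ?_
      exact (congrArg (fun f => (lift g x).left ≫ f) this).symm) b
  rw [h1, h2, ← map_mul]
  simp

/-- The morphism `Spec B ⟶ Spec A` given by `A → B`. -/
def specMapOver (φ : A →ₐ[ℂ] B) : specOver B ⟶ specOver A :=
  Over.homMk (Spec.map (CommRingCat.ofHom φ.toRingHom)) (by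
    refine (Spec.map_comp _ _).symm.trans ?_
    rw [← CommRingCat.ofHom_comp]
    exact congrArg (fun f => Spec.map (CommRingCat.ofHom f)) φ.comp_algebraMap)

theorem comorphism_comp_specMapOver (x : Y ⟶ specOver B) (φ : A →ₐ[ℂ] B) (a : A) :
    comorphism (x ≫ specMapOver φ) a = comorphism x (φ a) :=
  comorphism_specMap _ _ φ.toRingHom rfl a

end

section
variable {M : Type} [AddCommGroup M] {m : ℕ} (w : Fin m → M) {Y : Over SpecC}

theorem comorphism_mul (g h : Y ⟶ diagGroup M) (χ : M) :
    comorphism (g * h) (AddMonoidAlgebra.single χ 1) =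
      comorphism g (AddMonoidAlgebra.single χ 1) * comorphism h (AddMonoidAlgebra.single χ 1) := by
  have : g * h = (lift g h ≫ prodIso) ≫ specMapOver (Bialgebra.comulAlgHom ℂ (AddMonoidAlgebra ℂ M)) := by
    rw [Hom.mul_def, Category.assoc]
    rfl
  rw [this, comorphism_comp_specMapOver, ← comorphism_lift]
  simp

theorem comorphism_one (χ : M) :
    comorphism (1 : Y ⟶ diagGroup M) (AddMonoidAlgebra.single χ 1) = 1 := by
  have := comorphism_specMap (A := ℂ) (Over.homMk Y.hom (by
      refine (congrArg (fun f => Y.hom ≫ f) (?_ : _ = 𝟙 SpecC)).trans (Category.comp_id _)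
      exact Spec.map_id _)) (1 : Y ⟶ diagGroup M)
    (Bialgebra.counitAlgHom ℂ (AddMonoidAlgebra ℂ M)).toRingHom rfl (AddMonoidAlgebra.single χ 1)
  rw [this]
  simp

theorem affineSpaceC_ext {x y : Y ⟶ affineSpaceC m}
    (h : ∀ i, comorphism x (MvPolynomial.X i) = comorphism y (MvPolynomial.X i)) : x = y := by
  apply comorphism_ext
  apply MvPolynomial.ringHom_ext
  · intro c
    exact (comorphism_algebraMap x c).trans (comorphism_algebraMap y c).symm
  · exact h

/-- The coaction `ℂ[x_1, …, x_m] → ℂ[M] ⊗ ℂ[x_1, …, x_m]`, `x_i ↦ χ^{w i} ⊗ x_i`. -/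
def coaction : MvPolynomial (Fin m) ℂ →ₐ[ℂ] AddMonoidAlgebra ℂ M ⊗[ℂ] MvPolynomial (Fin m) ℂ :=
  MvPolynomial.aeval fun i => AddMonoidAlgebra.single (w i) 1 ⊗ₜ MvPolynomial.X i

/-- The map `D(M) × 𝔸^m ⟶ 𝔸^m`, `(t, x) ↦ (χ^{w i}(t) x_i)_i`. -/
def actionMap : diagGroup M ⊗ affineSpaceC m ⟶ affineSpaceC m :=
  prodIso ≫ specMapOver (coaction w)

/-- On points, `D(M)` multiplies the `i`-th coordinate by the character `w i`. -/
theorem comorphism_action (g : Y ⟶ diagGroup M) (x : Y ⟶ affineSpaceC m) (i : Fin m) :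
    comorphism (lift g x ≫ actionMap w) (MvPolynomial.X i) =
      comorphism g (AddMonoidAlgebra.single (w i) 1) * comorphism x (MvPolynomial.X i) := by
  rw [actionMap, ← Category.assoc, comorphism_comp_specMapOver, coaction, MvPolynomial.aeval_X,
    comorphism_lift]

theorem one_action (x : Y ⟶ affineSpaceC m) : lift 1 x ≫ actionMap w = x :=
  affineSpaceC_ext fun i => by rw [comorphism_action, comorphism_one, _root_.one_mul]

theorem mul_action (g h : Y ⟶ diagGroup M) (x : Y ⟶ affineSpaceC m) :
    lift (g * h) x ≫ actionMap w = lift g (lift h x ≫ actionMap w) ≫ actionMap w :=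
  affineSpaceC_ext fun i => by
    simp only [comorphism_action, comorphism_mul, _root_.mul_assoc]


/-- The ideal is generated by monomials. -/
def IsMonomialIdeal (J : Ideal (MvPolynomial (Fin m) ℂ)) : Prop :=
  ∃ T : Set (Fin m →₀ ℕ), J = Ideal.span ((fun s => MvPolynomial.monomial s 1) '' T)

/-- The complement of `V(J)` in `𝔸^m`, an open subset. -/
def openCompl (J : Ideal (MvPolynomial (Fin m) ℂ)) :
    (Spec (CommRingCat.of (MvPolynomial (Fin m) ℂ))).Opens :=
  ⟨(PrimeSpectrum.zeroLocus (J : Set (MvPolynomial (Fin m) ℂ)))ᶜ,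
    (PrimeSpectrum.isClosed_zeroLocus _).isOpen_compl⟩

/-- The open subscheme `𝔸^m ∖ V(J)` as a `ℂ`-scheme. -/
def openSub (J : Ideal (MvPolynomial (Fin m) ℂ)) : Over SpecC :=
  Over.mk ((openCompl J).ι ≫ (affineSpaceC m).hom)

/-- The inclusion of `𝔸^m ∖ V(J)` in `𝔸^m`. -/
def openSubι (J : Ideal (MvPolynomial (Fin m) ℂ)) : openSub J ⟶ affineSpaceC m :=
  Over.homMk (openCompl J).ι

instance (J : Ideal (MvPolynomial (Fin m) ℂ)) : Mono (openSubι J) := by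
  have : Mono (openSubι J).left := inferInstanceAs (Mono (openCompl J).ι)
  exact Over.mono_of_mono_left _

theorem mem_zeroLocus_iff {A : Type} [CommRing A] [Algebra ℂ A] (x : Y ⟶ specOver A)
   (y : Y.left) (a : A) : a ∈ (x.left y).asIdeal ↔ y ∉ Y.left.basicOpen (comorphism x a) := by
  have h : Y.left.basicOpen (comorphism x a) =
      x.left ⁻¹ᵁ PrimeSpectrum.basicOpen a := by
    refine Eq.trans ?_ (congrArg (fun U => x.left ⁻¹ᵁ U)
      (basicOpen_eq_of_affine (R := CommRingCat.of A) a))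
    exact (Scheme.preimage_basicOpen_top x.left _).symm
  rw [h]
  exact (not_not).symm

theorem mem_openCompl (J : Ideal (MvPolynomial (Fin m) ℂ)) (p : (affineSpaceC m).left) :
    p ∈ openCompl J ↔ ∃ f ∈ J, f ∉ p.asIdeal := by
  change ¬ ((J : Set (MvPolynomial (Fin m) ℂ)) ⊆ (p.asIdeal : Set _)) ↔ _
  rw [Set.not_subset]
  rfl

theorem comorphism_action_monomial (g : Y ⟶ diagGroup M) (x : Y ⟶ affineSpaceC m) (s : Fin m →₀ ℕ) :
   ∃ u : Γ(Y.left, ⊤), IsUnit u ∧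
    comorphism (lift g x ≫ actionMap w) (MvPolynomial.monomial s 1) =
      u * comorphism x (MvPolynomial.monomial s 1) := by
  refine ⟨∏ i, comorphism g (AddMonoidAlgebra.single (w i) 1) ^ s i, ?_, ?_⟩
  · refine IsUnit.prod_univ_iff.2 fun i => IsUnit.pow _ ?_
    refine IsUnit.of_mul_eq_one (comorphism g⁻¹ (AddMonoidAlgebra.single (w i) 1)) ?_
    rw [← comorphism_mul, mul_inv_cancel, comorphism_one]
  · simp only [MvPolynomial.monomial_eq, Finsupp.prod_fintype, map_one, _root_.one_mul, pow_zero,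
      implies_true, map_prod, map_pow, comorphism_action, mul_pow, Finset.prod_mul_distrib]

theorem action_mem {J : Ideal (MvPolynomial (Fin m) ℂ)} (hJ : IsMonomialIdeal J)
   (g : Y ⟶ diagGroup M) (x : Y ⟶ affineSpaceC m) (y : Y.left) (hy : x.left y ∈ openCompl J) :
   (lift g x ≫ actionMap w).left y ∈ openCompl J := by
  obtain ⟨T, rfl⟩ := hJ
  rw [mem_openCompl] at hy ⊢
  by_contra! hcon
  obtain ⟨f, hf, hfy⟩ := hy
  refine hfy ((Ideal.span_le (I := (x.left y).asIdeal)).2 ?_ hf)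
  rintro _ ⟨s, hs, rfl⟩
  have := hcon _ (Ideal.subset_span ⟨s, hs, rfl⟩)
  rw [SetLike.mem_coe]
  rw [mem_zeroLocus_iff] at this ⊢
  obtain ⟨u, hu, h⟩ := comorphism_action_monomial w g x s
  rwa [h, Scheme.basicOpen_mul, Scheme.basicOpen_of_isUnit _ hu, top_inf_eq] at this

theorem exists_lift_opens {X Y : Scheme.{0}} (U : X.Opens) (f : Y ⟶ X) (h : ∀ y, f y ∈ U) :
    ∃ l : Y ⟶ U.toScheme, l ≫ U.ι = f := by
  have hr : Set.range f ⊆ Set.range U.ι := by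
    rintro _ ⟨y, rfl⟩
    rw [Scheme.Opens.range_ι]
    exact h y
  exact ⟨IsOpenImmersion.lift U.ι f hr, IsOpenImmersion.lift_fac U.ι f hr⟩

theorem openSub_lift {J : Ideal (MvPolynomial (Fin m) ℂ)} (x : Y ⟶ affineSpaceC m)
    (h : ∀ y, x.left y ∈ openCompl J) : ∃ z : Y ⟶ openSub J, z ≫ openSubι J = x := by
  obtain ⟨l, hl⟩ := exists_lift_opens (openCompl J) x.left h
  refine ⟨Over.homMk l ?_, ?_⟩
  · refine Eq.trans ?_ (Over.w x)
    exact (Category.assoc _ _ _).symm.trans (congrArg (fun f => f ≫ (affineSpaceC m).hom) hl)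
  · ext1
    exact hl

theorem openSubι_mem {J : Ideal (MvPolynomial (Fin m) ℂ)} (z : Y ⟶ openSub J) (y : Y.left) :
    (z ≫ openSubι J).left y ∈ openCompl J :=
  (z.left y).2

theorem exists_openAction {J : Ideal (MvPolynomial (Fin m) ℂ)} (hJ : IsMonomialIdeal J) :
    ∃ a : diagGroup M ⊗ openSub J ⟶ openSub J,
      a ≫ openSubι J = lift (fst _ _) (snd _ _ ≫ openSubι J) ≫ actionMap w :=
  openSub_lift _ fun y => action_mem w hJ _ _ y (openSubι_mem _ y)

/-- The restriction of the action of `D(M)` to the invariant open subscheme `𝔸^m ∖ V(J)`, that is,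
the unique map compatible with `actionMap w` under the inclusion in `𝔸^m`. -/
def openAction {J : Ideal (MvPolynomial (Fin m) ℂ)} (hJ : IsMonomialIdeal J) :
    diagGroup M ⊗ openSub J ⟶ openSub J := (exists_openAction w hJ).choose

theorem openAction_comp {J : Ideal (MvPolynomial (Fin m) ℂ)} (hJ : IsMonomialIdeal J)
    (g : Y ⟶ diagGroup M) (z : Y ⟶ openSub J) :
    (lift g z ≫ openAction w hJ) ≫ openSubι J = lift g (z ≫ openSubι J) ≫ actionMap w := by
  rw [Category.assoc, openAction, (exists_openAction w hJ).choose_spec, ← Category.assoc]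
  congr 1
  ext1 <;> simp

/-- The action of `D(M)` on `𝔸^m ∖ V(J)` with weights `w`. -/
@[reducible] def openModObj {J : Ideal (MvPolynomial (Fin m) ℂ)} (hJ : IsMonomialIdeal J) :
    ModObj (diagGroup M) (openSub J) :=
  modObjOfPoints (openAction w hJ)
    (fun x => by rw [← cancel_mono (openSubι J), openAction_comp, one_action])
    (fun g h x => by
      rw [← cancel_mono (openSubι J), openAction_comp, mul_action, openAction_comp,
        openAction_comp])

end
/-! ### Quotient stacks -/

section QuotientStacks

/-- `p : T ⟶ S` is a `G`-torsor (for the fppf topology): it is faithfully flat and locally of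
finite presentation, `G` acts on `T` over `S`, and `G × T → T ×_S T`, `(g, t) ↦ (g t, t)`,
is an isomorphism. -/
structure IsTorsor (G : Over SpecC) [GrpObj G] {T S : Over SpecC} [ModObj G T] (p : T ⟶ S) :
    Prop where
  flat : Flat p.left
  surjective : Surjective p.left
  locallyOfFinitePresentation : LocallyOfFinitePresentation p.left
  isPullback : IsPullback (γ[G, T] : G ⊗ T ⟶ T) (snd G T) p p

variable (G Z : Over SpecC) [GrpObj G] [ModObj G Z]

/-- An object of `[Z/G]` over a `ℂ`-scheme `base`: a `G`-torsor with an equivariant map to `Z`. -/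
structure QuotientObj where
  base : Over SpecC
  torsor : Over SpecC
  action : ModObj G torsor
  proj : torsor ⟶ base
  isTorsor : IsTorsor G proj
  toZ : torsor ⟶ Z
  equivariant : IsModHom G toZ

attribute [instance] QuotientObj.action QuotientObj.equivariant

variable {G Z}

/-- A morphism in `[Z/G]`: an equivariant map of torsors over a map of the bases, compatible with
the maps to `Z` (the square over the bases is then automatically cartesian). -/
@[ext]
structure QuotientHom (X Y : QuotientObj G Z) where
  base : X.base ⟶ Y.base
  torsor : X.torsor ⟶ Y.torsor
  equivariant : IsModHom G torsor
  comm : torsor ≫ Y.proj = X.proj ≫ base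
  toZ : torsor ≫ Y.toZ = X.toZ

instance : Category (QuotientObj G Z) where
  Hom X Y := QuotientHom X Y
  id X := ⟨𝟙 _, 𝟙 _, inferInstance, by simp, by simp⟩
  comp {X Y W} f g :=
    ⟨f.base ≫ g.base, f.torsor ≫ g.torsor,
      have := f.equivariant
      have := g.equivariant
      inferInstance,
      by rw [Category.assoc, g.comm, ← Category.assoc, f.comm, Category.assoc],
      by rw [Category.assoc, g.toZ, f.toZ]⟩
  id_comp f := QuotientHom.ext (Category.id_comp _) (Category.id_comp _)
  comp_id f := QuotientHom.ext (Category.comp_id _) (Category.comp_id _)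
  assoc f g h := QuotientHom.ext (Category.assoc _ _ _) (Category.assoc _ _ _)

variable (G Z) in
/-- The quotient stack `[Z/G]`, as a category over the category of `ℂ`-schemes. -/
def quotientStack : BasedCategory (Over SpecC) where
  obj := QuotientObj G Z
  p :=
    { obj := fun X => X.base
      map := fun f => QuotientHom.base f
      map_id := fun _ => rfl
      map_comp := fun _ _ => rfl }

/-- Isomorphism of stacks over `ℂ`: a functor over the category of `ℂ`-schemes that is an
equivalence of categories. -/
def StackIso (X Y : BasedCategory.{0, 1} (Over SpecC)) : Prop :=
  ∃ F : BasedFunctor X Y, F.toFunctor.IsEquivalence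

end QuotientStacks

/-! ### Toric Deligne-Mumford stacks and weighted projective stacks -/

section ToricStacks

variable {M : Type} [AddCommGroup M] {m : ℕ}

/-- The quotient stack `[(𝔸^m ∖ V(J)) / D(M)]`, where the diagonalizable group `D(M)` acts on the
`i`-th coordinate through the character `w i ∈ M`. -/
def diagQuotient (w : Fin m → M) {J : Ideal (MvPolynomial (Fin m) ℂ)} (hJ : IsMonomialIdeal J) :
    BasedCategory.{0, 1} (Over SpecC) :=
  letI := openModObj w hJ
  quotientStack (diagGroup M) (openSub J)

/-- The ideal of the origin of `𝔸^m`. -/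
def originIdeal (m : ℕ) : Ideal (MvPolynomial (Fin m) ℂ) :=
  Ideal.span (Set.range MvPolynomial.X)

theorem originIdeal_isMonomialIdeal (m : ℕ) : IsMonomialIdeal (originIdeal m) := by
  refine ⟨Set.range fun i => Finsupp.single i 1, ?_⟩
  rw [← Set.range_comp]
  rfl

/-- The weighted projective stack `P(q_0, …, q_n) = [(𝔸^{n+1} ∖ 0) / 𝔾_m]`, where `𝔾_m = D(ℤ)` acts
by `λ (x_0, …, x_n) = (λ^{q_0} x_0, …, λ^{q_n} x_n)`. -/
def weightedProjectiveStack {n : ℕ} (q : Fin (n + 1) → ℕ) : BasedCategory.{0, 1} (Over SpecC) :=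
  diagQuotient (fun i => (q i : ℤ)) (originIdeal_isMonomialIdeal (n + 1))

namespace StackyFan

variable {N : Type} [AddCommGroup N] (F : StackyFan N m)

/-- The monomial `∏_{ρ_i ⊄ σ} z_i`. -/
def coxMonomial (σ : PointedCone ℚ (ℚ ⊗[ℤ] N)) : MvPolynomial (Fin m) ℂ :=
  open scoped Classical in
  ∏ i with ¬ rayOf (F.β (Pi.single i 1)) ≤ σ, MvPolynomial.X i

/-- The irrelevant ideal `J_Σ = ⟨∏_{ρ_i ⊄ σ} z_i : σ ∈ Σ⟩`. -/
def irrelevantIdeal : Ideal (MvPolynomial (Fin m) ℂ) :=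
  Ideal.span (F.coxMonomial '' F.cones)

theorem irrelevantIdeal_isMonomialIdeal : IsMonomialIdeal F.irrelevantIdeal := by
  classical
  refine ⟨(fun σ => ∑ i with ¬ rayOf (F.β (Pi.single i 1)) ≤ σ, Finsupp.single i 1) '' F.cones, ?_⟩
  rw [irrelevantIdeal, Set.image_image]
  congr 2
  ext1 σ
  rw [coxMonomial, MvPolynomial.monomial_sum_one]
  exact Finset.prod_congr (by congr) fun _ _ => rfl

/-- The toric Deligne-Mumford stack `X(Σ) = [Z/G]`, where `Z = 𝔸^m ∖ V(J_Σ)` and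
`G = Hom(DG(β), 𝔾_m) = D(DG(β))` acts through `G → 𝔾_m^m` dual to `β^∨ : ℤ^m → DG(β)`. -/
def toricStack (D : GaleData F.β) : BasedCategory.{0, 1} (Over SpecC) :=
  diagQuotient D.weight F.irrelevantIdeal_isMonomialIdeal

end StackyFan

end ToricStacks

end ToricDM

end

open ToricDM

noncomputable section

namespace ToricDM

/-! ### Change of the group of a quotient stack along an isomorphism -/

section ChangeOfGroup

/-! The relations among the `v i` form `ℤ a`: completing `v` by a functional with value 1 on `a`
gives a surjection `ℤ^{n+1} → ℤ × ℤ^n`, hence an injection (`eq_smul_of_sum_smul_eq_zero`). On `t a`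
the torsion component of `β` is `t` times the unit `∑ a_i c_i`. So `β` is surjective, and `t a` lies
in its kernel exactly when `d ∣ t`; the kernel is `ℤ q` with `q = d a`.

For any resolution and lift, `[B R]` is then a split surjection whose kernel is generated by one
vector `(q, y)`. Dually, evaluation at this vector identifies the cokernel `DG(β)` with `ℤ` and
turns `β^∨` into `f ↦ f(q)` (`GaleData.exists_equiv_int`).

Over `ℚ` the torsion disappears and the rays have one relation up to scale, with positive
coefficients. Hence a point has at most one nonnegative expression omitting some ray generator
(`HasPositiveRelation.eq_of_sum_eq`). All fan axioms follow, and a cone contains only the ray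
generators that span it, so `J_Σ` is the ideal of the origin
(`StackyFan.irrelevantIdeal_eq_originIdeal`).

Thus both stacks are quotients of `𝔸^{n+1} ∖ 0`, by groups identified by `DG(β) ≅ ℤ` compatibly with
the weights. Restricting torsors along this isomorphism is an equivalence (`stackIso_diagQuotient`).
For existence, a Bézout vector `y` for `a` splits `ℤ^{n+1}` as `ℤ a ⊕ ℤ^n` and supplies the `c_i`
modulo `d`. -/

/-- Restriction of an action along a homomorphism of monoid objects. -/
@[reducible] def restrictAction {C : Type*} [Category C] [CartesianMonoidalCategory C] {H G : C}
    [MonObj H] [MonObj G] (f : H ⟶ G) [IsMonHom f] (X : C) [ModObj G X] : ModObj H X where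
  smul := (f ▷ X) ≫ γ[G, X]
  one_smul := by
    change (η[H] ▷ X) ≫ (f ▷ X) ≫ γ[G, X] = (λ_ X).hom
    rw [← comp_whiskerRight_assoc, IsMonHom.one_hom, ModObj.one_smul_self]
  mul_smul := by
    change (MonObj.mul (X := H) ▷ X) ≫ (f ▷ X) ≫ γ[G, X] =
      (α_ H H X).hom ≫ (H ◁ ((f ▷ X) ≫ γ[G, X])) ≫ (f ▷ X) ≫ γ[G, X]
    rw [← comp_whiskerRight_assoc, IsMonHom.mul_hom, comp_whiskerRight_assoc,
      ModObj.mul_smul_self, whisker_exchange_assoc]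
    simp [MonoidalCategory.tensorHom_def]

theorem isModHom_restrictAction {C : Type*} [Category C] [CartesianMonoidalCategory C] {H G : C}
    [MonObj H] [MonObj G] (f : H ⟶ G) [IsMonHom f] {X Y : C} [ModObj G X] [ModObj G Y]
    (g : X ⟶ Y) [IsModHom G g] :
    letI := restrictAction f X
    letI := restrictAction f Y
    IsModHom H g := by
  let := restrictAction f X
  let := restrictAction f Y
  refine ⟨?_⟩
  change ((f ▷ X) ≫ γ[G, X]) ≫ g = (H ◁ g) ≫ (f ▷ Y) ≫ γ[G, Y]
  have := IsModHom.smul_hom (A := G) (f := g)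
  rw [Category.assoc, this, whisker_exchange_assoc]
  rfl

theorem restrictAction_restrictAction {C : Type*} [Category C] [CartesianMonoidalCategory C]
    {H G : C} [MonObj H] [MonObj G] (e : H ≅ G) [IsMonHom e.hom] (X : C) [i : ModObj H X] :
    (letI := restrictAction e.inv X; restrictAction e.hom X) = i := by
  apply ModObj.ext
  change (e.hom ▷ X) ≫ (e.inv ▷ X) ≫ γ[H, X] = γ[H, X]
  simp

variable {H G : Over SpecC} [GrpObj H] [GrpObj G] (e : H ≅ G) [IsMonHom e.hom]

/-- Only the cartesian square involves the group, and its corner `G ⊗ T` may be replaced by the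
isomorphic `H ⊗ T`. -/
theorem IsTorsor.restrictAction {T S : Over SpecC} [ModObj G T] {p : T ⟶ S} (h : IsTorsor G p) :
    letI := ToricDM.restrictAction e.hom T
    IsTorsor H p := by
  let := ToricDM.restrictAction e.hom T
  refine ⟨h.flat, h.surjective, h.locallyOfFinitePresentation, ?_⟩
  have h' := h.isPullback
  exact h'.of_iso (whiskerRightIso e.symm T) (Iso.refl _) (Iso.refl _) (Iso.refl _)
    (by simp [ModObj.smul]) (by simp) (by simp) (by simp)

variable (Z : Over SpecC) [ModObj H Z] [ModObj G Z]

/-- The functor `[Z/G] ⥤ [Z/H]` given by an isomorphism `H ≅ G` compatible with the actions. -/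
def restrictFunctor (he : γ[H, Z] = (e.hom ▷ Z) ≫ γ[G, Z]) :
    QuotientObj G Z ⥤ QuotientObj H Z where
  obj X :=
    { base := X.base
      torsor := X.torsor
      action := restrictAction e.hom X.torsor
      proj := X.proj
      isTorsor := X.isTorsor.restrictAction e
      toZ := X.toZ
      equivariant := by
        have h := isModHom_restrictAction e.hom X.toZ
        rwa [show restrictAction e.hom Z = ‹ModObj H Z› from ModObj.ext _ _ he.symm] at h }
  map {X Y} f :=
    { base := f.base
      torsor := f.torsor
      equivariant := by
        have := f.equivariant
        exact isModHom_restrictAction e.hom f.torsor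
      comm := f.comm
      toZ := f.toZ }
  map_id _ := rfl
  map_comp _ _ := rfl

theorem quotientObj_ext {X Y : QuotientObj H Z} (hb : X.base = Y.base) (ht : X.torsor = Y.torsor)
    (ha : X.action ≍ Y.action) (hp : X.proj ≍ Y.proj) (hz : X.toZ ≍ Y.toZ) : X = Y := by
  cases X
  cases Y
  cases hb
  cases ht
  cases ha
  cases hp
  cases hz
  rfl

theorem restrictFunctor_isEquivalence (he : γ[H, Z] = (e.hom ▷ Z) ≫ γ[G, Z]) :
    (restrictFunctor e Z he).IsEquivalence where
  faithful :=
    { map_injective := fun {X Y} f g h => by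
        exact QuotientHom.ext (congrArg QuotientHom.base h :) (congrArg QuotientHom.torsor h :) }
  full :=
    { map_surjective := fun {X Y} f => by
        refine ⟨⟨f.base, f.torsor, ⟨?_⟩, f.comm, f.toZ⟩, rfl⟩
        have h : ((e.hom ▷ X.torsor) ≫ γ[G, X.torsor]) ≫ f.torsor =
            (H ◁ f.torsor) ≫ (e.hom ▷ Y.torsor) ≫ γ[G, Y.torsor] := f.equivariant.smul_hom
        have h' := (Category.assoc _ _ _).symm.trans (h.trans (whisker_exchange_assoc e.hom
          (show X.torsor ⟶ Y.torsor from f.torsor) γ[G, Y.torsor]))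
        -- `H`-equivariance is `G`-equivariance precomposed with the isomorphism `e.hom ▷ X.torsor`,
        -- which cancels.
        exact (cancel_epi (e.hom ▷ X.torsor)).1 h' }
  essSurj :=
    { mem_essImage := fun Y => by
        have he' : γ[G, Z] = (e.symm.hom ▷ Z) ≫ γ[H, Z] := by simp [he]
        have : IsMonHom e.symm.hom := inferInstanceAs (IsMonHom e.inv)
        -- Restricting along `e⁻¹` and then `e` returns the same action on the same torsor, so the
        -- preimage is strict.
        refine ⟨(restrictFunctor e.symm Z he').obj Y, ⟨eqToIso ?_⟩⟩
        exact quotientObj_ext Z rfl rfl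
          (heq_of_eq (restrictAction_restrictAction e Y.torsor)) HEq.rfl HEq.rfl }

theorem stackIso_of_groupIso (he : γ[H, Z] = (e.hom ▷ Z) ≫ γ[G, Z]) :
    StackIso (quotientStack G Z) (quotientStack H Z) :=
  ⟨{ toFunctor := restrictFunctor e Z he, w := rfl }, restrictFunctor_isEquivalence e Z he⟩

end ChangeOfGroup

/-! ### Diagonalizable groups as functors of the character group. -/

section DiagGroup

variable {M M' : Type} [AddCommGroup M] [AddCommGroup M'] {Y : Over SpecC}

/-- The group algebra is generated by scalars and characters, and the structure map to `Spec ℂ`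
fixes the scalars. -/
theorem diagGroup_ext {x y : Y ⟶ diagGroup M}
    (h : ∀ χ, comorphism x (AddMonoidAlgebra.single χ 1) =
      comorphism y (AddMonoidAlgebra.single χ 1)) : x = y := by
  apply comorphism_ext
  apply AddMonoidAlgebra.ringHom_ext
  · intro c
    exact (comorphism_algebraMap x c).trans (comorphism_algebraMap y c).symm
  · exact h

/-- The homomorphism `D(M') ⟶ D(M)` given by `M → M'`. -/
def diagGroupMap (f : M →+ M') : diagGroup M' ⟶ diagGroup M :=
  specMapOver (AddMonoidAlgebra.mapDomainAlgHom ℂ ℂ f)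

theorem comorphism_comp_diagGroupMap (f : M →+ M') (x : Y ⟶ diagGroup M') (χ : M) :
    comorphism (x ≫ diagGroupMap f) (AddMonoidAlgebra.single χ 1) =
      comorphism x (AddMonoidAlgebra.single (f χ) 1) := by
  rw [diagGroupMap, comorphism_comp_specMapOver]
  simp

instance (f : M →+ M') : IsMonHom (diagGroupMap f) where
  one_hom := diagGroup_ext fun χ => by
    rw [comorphism_comp_diagGroupMap]
    have h := comorphism_one (Y := 𝟙_ _) (f χ)
    have h' := comorphism_one (Y := 𝟙_ _) χ
    rw [Hom.one_def, toUnit_unique (toUnit _) (𝟙 _), Category.id_comp] at h h'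
    rw [h, h']
  mul_hom := diagGroup_ext fun χ => by
    rw [comorphism_comp_diagGroupMap]
    have h : ∀ {N : Type} [AddCommGroup N], μ[diagGroup N] = fst _ _ * snd _ _ := by
      intro N _
      simp [Hom.mul_def]
    rw [h, h, comorphism_mul, MonObj.comp_mul, comorphism_mul, tensorHom_fst, tensorHom_snd,
      comorphism_comp_diagGroupMap, comorphism_comp_diagGroupMap]

/-- An isomorphism `M ≃ M'` induces an isomorphism `D(M') ≅ D(M)`. -/
def diagGroupIso (f : M ≃+ M') : diagGroup M' ≅ diagGroup M where
  hom := diagGroupMap (f : M →+ M')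
  inv := diagGroupMap (f.symm : M' →+ M)
  hom_inv_id := diagGroup_ext fun χ => by
    rw [comorphism_comp_diagGroupMap]
    have := comorphism_comp_diagGroupMap (f : M →+ M') (𝟙 _) (f.symm χ)
    rw [Category.id_comp] at this
    simp [this]
  inv_hom_id := diagGroup_ext fun χ => by
    rw [comorphism_comp_diagGroupMap]
    have := comorphism_comp_diagGroupMap (f.symm : M' →+ M) (𝟙 _) (f χ)
    rw [Category.id_comp] at this
    simp [this]

theorem stackIso_diagQuotient {m : ℕ} (f : M ≃+ M') (w : Fin m → M) (w' : Fin m → M')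
    (hw : ∀ i, f (w i) = w' i) {J J' : Ideal (MvPolynomial (Fin m) ℂ)} (h : J = J')
    (hJ : IsMonomialIdeal J) (hJ' : IsMonomialIdeal J') :
    StackIso (diagQuotient w hJ) (diagQuotient w' hJ') := by
  subst h
  let : ModObj (diagGroup M) (openSub J) := openModObj w hJ
  let : ModObj (diagGroup M') (openSub J) := openModObj w' hJ
  have : IsMonHom (diagGroupIso f).hom := inferInstanceAs (IsMonHom (diagGroupMap (f : M →+ M')))
  refine stackIso_of_groupIso (diagGroupIso f) (openSub J) ?_
  change openAction w' hJ = (diagGroupMap (f : M →+ M') ▷ openSub J) ≫ openAction w hJ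
  have h1 : openAction w' hJ = lift (fst _ _) (snd _ _) ≫ openAction w' hJ := by simp
  have h2 : diagGroupMap (f : M →+ M') ▷ openSub J =
      lift (fst _ _ ≫ diagGroupMap (f : M →+ M')) (snd _ _) := by
    ext1 <;> simp
  -- Both actions are compared inside affine space, one coordinate at a time.
  rw [h1, h2, ← cancel_mono (openSubι J), openAction_comp, openAction_comp]
  refine affineSpaceC_ext fun i => ?_
  rw [comorphism_action, comorphism_action, comorphism_comp_diagGroupMap]
  simp [hw]

end DiagGroup

/-! ### Lattices spanned by vectors with one positive relation -/

section Lattice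

/-- A generator of the ideal spanned by the `a i` divides each of them, hence divides their gcd and
is a unit. -/
theorem exists_sum_mul_eq_one {S : Type*} [Fintype S] {a : S → ℕ}
    (ha : Finset.univ.gcd a = 1) : ∃ y : S → ℤ, ∑ i, y i * (a i : ℤ) = 1 := by
  obtain ⟨g, hg⟩ := IsPrincipalIdealRing.principal (Ideal.span (Set.range fun i => (a i : ℤ)))
  have hdvd : g.natAbs ∣ Finset.univ.gcd a := Finset.dvd_gcd fun i _ => by
    have : (a i : ℤ) ∈ Ideal.span (Set.range fun i => (a i : ℤ)) :=
      Ideal.subset_span ⟨i, rfl⟩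
    rw [hg] at this
    exact Int.natAbs_dvd_natAbs.2 (Ideal.mem_span_singleton.1 this)
  rw [ha] at hdvd
  have h1 : (1 : ℤ) ∈ Submodule.span ℤ (Set.range fun i => (a i : ℤ)) := by
    change (1 : ℤ) ∈ Ideal.span _
    rw [hg]
    exact Ideal.mem_span_singleton.2 (Int.isUnit_iff_natAbs_eq.2 (Nat.dvd_one.1 hdvd)).dvd
  obtain ⟨y, hy⟩ := (Submodule.mem_span_range_iff_exists_fun ℤ).1 h1
  exact ⟨y, hy⟩

/-- A complement of a unimodular vector `a` in `ℤ^{n+1}` provides vectors generating `ℤ^n` whose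
relations are spanned by `a`. -/
theorem exists_generators_of_sum_mul_eq_one {n : ℕ} {a y : Fin (n + 1) → ℤ}
    (h : ∑ i, y i * a i = 1) :
    ∃ v : Fin (n + 1) → (Fin n → ℤ), Submodule.span ℤ (Set.range v) = ⊤ ∧ ∑ i, a i • v i = 0 := by
  let φ : (Fin (n + 1) → ℤ) →ₗ[ℤ] ℤ := Fintype.linearCombination ℤ y
  have hφ : ∀ x, φ x = ∑ i, x i * y i := fun x => by simp [φ, Fintype.linearCombination_apply]
  have hφa : φ a = 1 := by rw [hφ, ← h]; exact Finset.sum_congr rfl fun i _ => by ring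
  -- The projection `x ↦ x - φ(x) a` along `a`. The required vectors are its values on the standard
  -- basis, read in a basis of `ker φ`.
  let π : (Fin (n + 1) → ℤ) →ₗ[ℤ] LinearMap.ker φ :=
    LinearMap.codRestrict _ (LinearMap.id - φ.smulRight a) fun x => by
      simp only [LinearMap.mem_ker, LinearMap.sub_apply, LinearMap.id_apply,
        LinearMap.smulRight_apply, map_sub, map_smul, hφa, smul_eq_mul, _root_.mul_one, sub_self]
  have hπ' : ∀ x, (π x : Fin (n + 1) → ℤ) = x - φ x • a := fun x => rfl
  have hπ : Function.Surjective π := fun x => ⟨x, Subtype.ext (by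
    rw [hπ', LinearMap.mem_ker.1 x.2, zero_smul, sub_zero])⟩
  have hπa : π a = 0 := Subtype.ext (by rw [hπ', hφa, one_smul, sub_self]; rfl)
  have hφs : Function.Surjective φ := fun t => ⟨t • a, by rw [map_smul, hφa, smul_eq_mul, _root_.mul_one]⟩
  have hrank : Module.finrank ℤ (LinearMap.ker φ) = Module.finrank ℤ (Fin n → ℤ) := by
    have h1 := Submodule.finrank_quotient_add_finrank (LinearMap.ker φ)
    rw [(φ.quotKerEquivOfSurjective hφs).finrank_eq] at h1
    simp at h1
    simp
    lia
  let E := LinearEquiv.ofFinrankEq _ _ hrank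
  let f : (Fin (n + 1) → ℤ) →ₗ[ℤ] (Fin n → ℤ) := E.toLinearMap ∘ₗ π
  have hf : Fintype.linearCombination ℤ (fun i => f (Pi.single i 1)) = f := by
    refine LinearMap.pi_ext' fun i => ?_
    ext1
    simp
  refine ⟨fun i => f (Pi.single i 1), ?_, ?_⟩
  · rw [← Fintype.range_linearCombination, hf, LinearMap.range_eq_top]
    exact E.surjective.comp hπ
  · rw [← Fintype.linearCombination_apply, hf]
    simp [f, hπa]

/-- If `v_0, …, v_n` generate `R^n` and `a` is a unimodular relation between them, every relation
is a multiple of `a`. -/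
theorem eq_smul_of_sum_smul_eq_zero {R : Type*} [CommRing R] [Nontrivial R] {n : ℕ}
    {v : Fin (n + 1) → (Fin n → R)} {a y : Fin (n + 1) → R}
    (hv : Submodule.span R (Set.range v) = ⊤) (hav : ∑ i, a i • v i = 0)
    (hy : ∑ i, y i * a i = 1) {x : Fin (n + 1) → R} (hx : ∑ i, x i • v i = 0) :
    ∃ t : R, x = t • a := by
  let f : (Fin (n + 1) → R) →ₗ[R] (Fin n → R) := Fintype.linearCombination R v
  let φ : (Fin (n + 1) → R) →ₗ[R] R := Fintype.linearCombination R y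
  have hφa : φ a = 1 := by
    rw [← hy]
    simp [φ, Fintype.linearCombination_apply, mul_comm]
  have hfa : f a = 0 := hav
  have hfs : Function.Surjective f := by
    rw [← LinearMap.range_eq_top, Fintype.range_linearCombination, hv]
  have hs : Function.Surjective (φ.prod f) := by
    rintro ⟨t, z⟩
    obtain ⟨p, rfl⟩ := hfs z
    exact ⟨p + (t - φ p) • a, by simp [hφa, hfa]⟩
  -- A surjection between free modules of rank `n + 1` is injective; `x` and `φ(x) a` have the same
  -- image.
  have hi := OrzechProperty.injective_of_surjective_of_injective
    (Fin.consLinearEquiv R fun _ : Fin (n + 1) => R).symm.toLinearMap (φ.prod f)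
    (LinearEquiv.injective _) hs
  refine ⟨φ x, hi ?_⟩
  have hfx : f x = 0 := hx
  simp [hφa, hfa, hfx]

end Lattice

/-! ### The Gale dual of a surjective homomorphism with cyclic kernel -/

section Gale

variable {N : Type} [AddCommGroup N] {m : ℕ} {β : (Fin m → ℤ) →ₗ[ℤ] N}

theorem GaleData.exists_equiv_int (D : GaleData β) (hβ : Function.Surjective β)
    {k : Fin m → ℤ} (hk : k ≠ 0) (hβk : β k = 0) (hker : ∀ x, β x = 0 → ∃ t : ℤ, x = t • k) :
    ∃ e : D.DG ≃ₗ[ℤ] ℤ, ∀ f, e (D.dual f) = f k := by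
  have haug : ∀ x, D.aug (D.lift x) = β x := fun x => LinearMap.congr_fun D.aug_comp_lift x
  have hrel : ∀ z, D.aug z = 0 → ∃ y, D.rel y = z := fun z hz => (D.exact z).1 hz
  have hC : ∀ p, D.coneMap p = D.lift p.1 + D.rel p.2 := fun p => rfl
  have hsurj : Function.Surjective D.coneMap := fun z => by
    obtain ⟨x, hx⟩ := hβ (D.aug z)
    obtain ⟨y, hy⟩ := hrel (z - D.lift x) (by rw [map_sub, haug, hx, sub_self])
    exact ⟨(x, y), by rw [hC, hy]; abel⟩
  -- The lift sends `k` to a relation of the resolution; `y` cancels it, so that `(k, y)` is in the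
  -- kernel of the cone map.
  obtain ⟨y, hy⟩ := hrel (-D.lift k) (by rw [map_neg, haug, hβk, neg_zero])
  let κ : (Fin m → ℤ) × (Fin D.r → ℤ) := (k, y)
  have hκ : κ ≠ 0 := fun h => hk (congrArg Prod.fst h)
  have hCκ : D.coneMap κ = 0 := by simp [hC, κ, hy]
  have hkerC : ∀ p, D.coneMap p = 0 → p ∈ Submodule.span ℤ {κ} := fun p hp => by
    have hp1 : β p.1 = 0 := by
      rw [← haug, eq_neg_of_add_eq_zero_left ((hC p).symm.trans hp), map_neg,
        D.exact.apply_apply_eq_zero, neg_zero]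
    obtain ⟨t, ht⟩ := hker _ hp1
    refine Submodule.mem_span_singleton.2 ⟨t, Prod.ext ht.symm (D.rel_injective ?_)⟩
    have h1 : D.lift p.1 + D.rel p.2 = 0 := hp
    rw [ht, map_smul, add_eq_zero_iff_eq_neg'] at h1
    rw [h1]
    change D.rel (t • y) = _
    rw [map_smul, hy, smul_neg]
  obtain ⟨σ, hσ⟩ := Module.projective_lifting_property D.coneMap LinearMap.id hsurj
  have hσ' : ∀ z, D.coneMap (σ z) = z := fun z => LinearMap.congr_fun hσ z
  let π : (Fin m → ℤ) × (Fin D.r → ℤ) →ₗ[ℤ] Submodule.span ℤ {κ} :=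
    LinearMap.codRestrict _ (LinearMap.id - σ ∘ₗ D.coneMap) fun p => hkerC _ (by simp [hσ'])
  let ev : Module.Dual ℤ ((Fin m → ℤ) × (Fin D.r → ℤ)) →ₗ[ℤ] ℤ := Module.Dual.eval ℤ _ κ
  have hev : Function.Surjective ev := fun t => by
    let E := LinearEquiv.toSpanNonzeroSingleton ℤ ((Fin m → ℤ) × (Fin D.r → ℤ)) κ hκ
    -- The splitting projects onto `ℤ κ`; the `κ`-coordinate of this projection is a functional with
    -- value 1 at `κ`.
    refine ⟨t • (E.symm.toLinearMap ∘ₗ π), ?_⟩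
    have h1 : π κ = E 1 := Subtype.ext (by simp [π, hCκ, E])
    simp [ev, h1]
  have hr : LinearMap.range D.coneMap.dualMap = LinearMap.ker ev := by
    ext φ
    constructor
    · rintro ⟨ψ, rfl⟩
      simp [ev, hCκ]
    · intro (h : φ κ = 0)
      -- A functional killing `κ` does not see the difference between `p` and `σ (D.coneMap p)`, so
      -- it factors through the cone map.
      refine ⟨φ ∘ₗ σ, LinearMap.ext fun p => ?_⟩
      obtain ⟨t, ht⟩ := Submodule.mem_span_singleton.1 (π p).2
      have h1 : p - σ (D.coneMap p) = t • κ := ht.symm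
      have h2 := congrArg φ h1
      rw [map_sub, map_smul, h, smul_zero, sub_eq_zero] at h2
      exact h2.symm
  refine ⟨(Submodule.quotEquivOfEq _ _ hr).trans (ev.quotKerEquivOfSurjective hev), fun f => ?_⟩
  rfl

end Gale

/-! ### The fan of the proper subsets of vectors with one positive relation -/

section Fan

variable {V : Type} [AddCommGroup V] [Module ℚ V] {S : Type} [Fintype S]

/-- The relations between the vectors `u i` are the multiples of one relation `a` with positive
coefficients. -/
structure HasPositiveRelation (u : S → V) (a : S → ℚ) : Prop where
  pos : ∀ i, 0 < a i
  sum_eq_zero : ∑ i, a i • u i = 0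
  eq_smul : ∀ x : S → ℚ, ∑ i, x i • u i = 0 → ∃ t : ℚ, x = t • a

/-- Coefficients are indexed by all of `S` and vanish off `I`, so that expressions over different
subsets can be compared. -/
theorem mem_hull_image_iff (u : S → V) (I : Set S) (p : V) :
    p ∈ PointedCone.hull ℚ (u '' I) ↔
      ∃ x : S → ℚ, (∀ i, 0 ≤ x i) ∧ (∀ i ∉ I, x i = 0) ∧ ∑ i, x i • u i = p := by
  classical
  constructor
  · intro hp
    induction hp using Submodule.span_induction with
    | mem p hp =>
      obtain ⟨i, hi, rfl⟩ := hp
      refine ⟨Pi.single i 1, fun j => ?_, fun j hj => ?_, ?_⟩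
      · by_cases h : j = i
        · subst h; simp
        · simp [h]
      · exact Pi.single_eq_of_ne (by rintro rfl; exact hj hi) _
      · simp [Pi.single_apply, ite_smul]
    | zero => exact ⟨0, by simp, by simp, by simp⟩
    | add p r _ _ hp hr =>
      obtain ⟨x, hx, hxI, rfl⟩ := hp
      obtain ⟨z, hz, hzI, rfl⟩ := hr
      exact ⟨x + z, fun i => add_nonneg (hx i) (hz i),
        fun i hi => by simp [hxI i hi, hzI i hi],
        by simp [add_smul, Finset.sum_add_distrib]⟩
    | smul c p _ hp =>
      obtain ⟨x, hx, hxI, rfl⟩ := hp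
      refine ⟨(c : ℚ) • x, fun i => mul_nonneg c.2 (hx i), fun i hi => by simp [hxI i hi], ?_⟩
      rw [← Nonneg.coe_smul, Finset.smul_sum]
      simp [mul_smul]
  · rintro ⟨x, hx, hxI, rfl⟩
    refine Submodule.sum_mem _ fun i _ => ?_
    by_cases hi : i ∈ I
    · exact Submodule.smul_mem _ (⟨x i, hx i⟩ : {c : ℚ // 0 ≤ c})
        (PointedCone.subset_hull (Set.mem_image_of_mem u hi))
    · rw [hxI i hi, zero_smul]
      exact zero_mem _

theorem sum_single_smul [DecidableEq S] (u : S → V) (i : S) :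
    ∑ j, (Pi.single i (1 : ℚ) : S → ℚ) j • u j = u i := by
  simp [Pi.single_apply, ite_smul]

/-- The cones generated by the proper subsets of a family of vectors. -/
def properCones (u : S → V) : Set (PointedCone ℚ V) :=
  {σ | ∃ I : Finset S, I ≠ Finset.univ ∧ σ = PointedCone.hull ℚ (u '' (I : Set S))}

theorem mem_properCones {u : S → V} {σ : PointedCone ℚ V} :
    σ ∈ properCones u ↔ ∃ I : Set S, I ≠ Set.univ ∧ σ = PointedCone.hull ℚ (u '' I) := by
  classical
  constructor
  · rintro ⟨I, hI, rfl⟩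
    exact ⟨I, by simpa using hI, rfl⟩
  · rintro ⟨I, hI, rfl⟩
    exact ⟨I.toFinset, by simpa using hI, by simp⟩

namespace HasPositiveRelation

variable {u : S → V} {a : S → ℚ}

/-- The difference `x - z` is `t a`; since `z` vanishes at `j`, this coordinate shows `t ≥ 0`. -/
theorem le_of_sum_eq (h : HasPositiveRelation u a) {x z : S → ℚ} (hx : ∀ i, 0 ≤ x i) {j : S} (hj : z j = 0)
    (hxz : ∑ i, x i • u i = ∑ i, z i • u i) (i : S) : z i ≤ x i := by
  obtain ⟨t, ht⟩ := h.eq_smul (x - z) (by simp [sub_smul, hxz])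
  have h1 : ∀ i, x i - z i = t * a i := fun i => congrFun ht i
  have h2 : 0 ≤ t * a j := by rw [← h1, hj, sub_zero]; exact hx j
  have h3 : 0 ≤ t := nonneg_of_mul_nonneg_left h2 (h.pos j)
  have := mul_nonneg h3 (h.pos i).le
  rw [← h1] at this
  linarith

/-- A point has at most one expression as a nonnegative combination of the `u i` that omits one of
the vectors. -/
theorem eq_of_sum_eq (h : HasPositiveRelation u a) {x z : S → ℚ} (hx : ∀ i, 0 ≤ x i) (hz : ∀ i, 0 ≤ z i) {j k : S}
    (hj : x j = 0) (hk : z k = 0) (hxz : ∑ i, x i • u i = ∑ i, z i • u i) : x = z :=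
  funext fun i => le_antisymm (h.le_of_sum_eq hz hj hxz.symm i) (h.le_of_sum_eq hx hk hxz i)

theorem linearIndepOn (h : HasPositiveRelation u a) {I : Set S} (hI : I ≠ Set.univ) : LinearIndepOn ℚ u I := by
  classical
  obtain ⟨j, hj⟩ := (Set.ne_univ_iff_exists_notMem I).1 hI
  rw [linearIndepOn_iff']
  intro s g hs hg i hi
  obtain ⟨t, ht⟩ := h.eq_smul (fun i => if i ∈ s then g i else 0) (by
    simpa [ite_smul, Finset.sum_ite_mem] using hg)
  have h1 := congrFun ht j
  rw [if_neg fun hjs => hj (hs (Finset.mem_coe.2 hjs))] at h1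
  have ht0 : t = 0 := by simpa [(h.pos j).ne'] using h1.symm
  simpa [hi, ht0] using congrFun ht i

theorem hull_inf_hull (h : HasPositiveRelation u a) {I J : Set S} (hI : I ≠ Set.univ) (hJ : J ≠ Set.univ) :
    PointedCone.hull ℚ (u '' I) ⊓ PointedCone.hull ℚ (u '' J) =
      PointedCone.hull ℚ (u '' (I ∩ J)) := by
  obtain ⟨j, hj⟩ := (Set.ne_univ_iff_exists_notMem I).1 hI
  obtain ⟨k, hk⟩ := (Set.ne_univ_iff_exists_notMem J).1 hJ
  refine le_antisymm ?_ (le_inf (Submodule.span_mono (Set.image_mono Set.inter_subset_left))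
    (Submodule.span_mono (Set.image_mono Set.inter_subset_right)))
  rintro p ⟨hp, hp'⟩
  obtain ⟨x, hx, hxI, rfl⟩ := (mem_hull_image_iff u I p).1 hp
  obtain ⟨z, hz, hzJ, hxz⟩ := (mem_hull_image_iff u J _).1 hp'
  obtain rfl := h.eq_of_sum_eq hz hx (hzJ k hk) (hxI j hj) hxz
  refine (mem_hull_image_iff u _ _).2 ⟨z, hz, fun i hi => ?_, rfl⟩
  by_cases hi' : i ∈ I
  · exact hzJ i fun h => hi ⟨hi', h⟩
  · exact hxI i hi'

theorem mem_hull_iff (h : HasPositiveRelation u a) [Nontrivial S] {I : Set S} (hI : I ≠ Set.univ) {i : S} :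
    u i ∈ PointedCone.hull ℚ (u '' I) ↔ i ∈ I := by
  classical
  refine ⟨fun hi => ?_, fun hi => PointedCone.subset_hull (Set.mem_image_of_mem u hi)⟩
  obtain ⟨j, hj⟩ := (Set.ne_univ_iff_exists_notMem I).1 hI
  obtain ⟨k, hk⟩ := exists_ne i
  obtain ⟨x, hx, hxI, hxi⟩ := (mem_hull_image_iff u I _).1 hi
  -- The competing expression is `u i` itself, which omits an index `k ≠ i`.
  have h1 : x = Pi.single i 1 := h.eq_of_sum_eq hx
    (Pi.single_nonneg.2 zero_le_one) (hxI j hj) (Pi.single_eq_of_ne hk _)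
    (hxi.trans (sum_single_smul u i).symm)
  by_contra hi'
  simpa [h1] using hxI i hi'

theorem isFaceOf_hull (h : HasPositiveRelation u a) {I K : Set S} (hI : I ≠ Set.univ) (hK : K ⊆ I) :
    (PointedCone.hull ℚ (u '' K)).IsFaceOf (PointedCone.hull ℚ (u '' I)) := by
  obtain ⟨j, hj⟩ := (Set.ne_univ_iff_exists_notMem I).1 hI
  refine ⟨Submodule.span_mono (Set.image_mono hK), fun {p r c} hp hr hc hpr => ?_⟩
  obtain ⟨x, hx, hxI, rfl⟩ := (mem_hull_image_iff u I p).1 hp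
  obtain ⟨z, hz, hzI, rfl⟩ := (mem_hull_image_iff u I r).1 hr
  obtain ⟨w, hw, hwK, hxz⟩ := (mem_hull_image_iff u K _).1 hpr
  -- By uniqueness the coefficients add up; a vanishing sum of nonnegative terms off `K` forces `x`
  -- to vanish there.
  have h1 : w = c • x + z := h.eq_of_sum_eq hw
    (fun i => add_nonneg (mul_nonneg hc.le (hx i)) (hz i)) (hwK j fun h => hj (hK h))
    (j := j) (k := j) (by simp [hxI j hj, hzI j hj])
    (by rw [hxz]; simp [add_smul, mul_smul, Finset.sum_add_distrib, Finset.smul_sum])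
  refine (mem_hull_image_iff u K _).2 ⟨x, hx, fun i hi => ?_, rfl⟩
  have h2 : c * x i + z i = 0 := (congrFun h1 i).symm.trans (hwK i hi)
  have h3 : c * x i = 0 := le_antisymm (by linarith [hz i]) (mul_nonneg hc.le (hx i))
  exact (mul_eq_zero.1 h3).resolve_left hc.ne'

/-- No relation is involved: a generator with positive coefficient in a point of a face belongs to
that face. -/
theorem eq_hull_of_isFaceOf {I : Set S} {τ : PointedCone ℚ V}
    (hτ : τ.IsFaceOf (PointedCone.hull ℚ (u '' I))) :
    ∃ K ⊆ I, τ = PointedCone.hull ℚ (u '' K) := by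
  classical
  refine ⟨{i | i ∈ I ∧ u i ∈ τ}, fun i hi => hi.1, le_antisymm (fun p hp => ?_) ?_⟩
  · obtain ⟨x, hx, hxI, rfl⟩ := (mem_hull_image_iff u I p).1 (hτ.le hp)
    refine (mem_hull_image_iff u _ _).2 ⟨x, hx, fun i hi => ?_, rfl⟩
    by_contra h0
    have hiI : i ∈ I := by
      by_contra hiI
      exact h0 (hxI i hiI)
    refine hi ⟨hiI, ?_⟩
    -- The face property needs every summand in the big cone, so generators outside `I` are replaced
    -- by `0`.
    have hs : ∑ j, x j • (if j ∈ I then u j else 0) = ∑ j, x j • u j := by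
      refine Finset.sum_congr rfl fun j _ => ?_
      by_cases hj : j ∈ I
      · rw [if_pos hj]
      · rw [hxI j hj, zero_smul, zero_smul]
    have := hτ.mem_of_sum_smul_mem (f := fun j => if j ∈ I then u j else 0) (c := x)
      (fun j => by
        by_cases hj : j ∈ I
        · simp only [if_pos hj]
          exact PointedCone.subset_hull (Set.mem_image_of_mem u hj)
        · simp only [if_neg hj]
          exact zero_mem _) hx (by rw [hs]; exact hp) i (lt_of_le_of_ne (hx i) (Ne.symm h0))
    simpa only [if_pos hiI] using this
  · refine Submodule.span_le.2 ?_
    rintro _ ⟨i, hi, rfl⟩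
    exact hi.2

theorem finrank_span_hull (h : HasPositiveRelation u a) {I : Set S} (hI : I ≠ Set.univ) :
    Module.finrank ℚ (Submodule.span ℚ (PointedCone.hull ℚ (u '' I) : Set V)) = I.ncard := by
  classical
  have hli := h.linearIndepOn hI
  rw [PointedCone.hull, Submodule.span_span_of_tower]
  rw [finrank_span_set_eq_card hli.id_image, Set.toFinset_card, ← Nat.card_eq_fintype_card,
    Nat.card_coe_set_eq, hli.injOn.ncard_image]

theorem isSimplicialFan (h : HasPositiveRelation u a) [Nonempty S] : IsSimplicialFan (properCones u) where
  finite := by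
    refine (Set.finite_range fun I : Finset S => PointedCone.hull ℚ (u '' (I : Set S))).subset ?_
    rintro _ ⟨I, -, rfl⟩
    exact ⟨I, rfl⟩
  nonempty := ⟨_, ∅, Finset.univ_nonempty.ne_empty.symm, rfl⟩
  simplicial := by
    intro σ hσ
    obtain ⟨I, hI, rfl⟩ := mem_properCones.1 hσ
    exact .hull (Set.toFinite _) (h.linearIndepOn hI).id_image
  face_mem := by
    intro σ hσ τ hτ
    obtain ⟨I, hI, rfl⟩ := mem_properCones.1 hσ
    obtain ⟨K, hK, rfl⟩ := eq_hull_of_isFaceOf hτ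
    exact mem_properCones.2 ⟨K, fun h => hI (Set.univ_subset_iff.1 (h ▸ hK)), rfl⟩
  inf_isFaceOf := by
    intro σ hσ τ hτ
    obtain ⟨I, hI, rfl⟩ := mem_properCones.1 hσ
    obtain ⟨J, hJ, rfl⟩ := mem_properCones.1 hτ
    rw [h.hull_inf_hull hI hJ]
    exact ⟨h.isFaceOf_hull hI Set.inter_subset_left, h.isFaceOf_hull hJ Set.inter_subset_right⟩

theorem bijOn_rays (h : HasPositiveRelation u a) [Nontrivial S] : Set.BijOn (fun i => PointedCone.hull ℚ {u i}) Set.univ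
    {ρ | ρ ∈ properCones u ∧ Module.finrank ℚ (Submodule.span ℚ (ρ : Set V)) = 1} := by
  have hne : ∀ i : S, ({i} : Set S) ≠ Set.univ := fun i => Set.singleton_ne_univ i
  have hs : ∀ i, PointedCone.hull ℚ {u i} = PointedCone.hull ℚ (u '' {i}) := fun i => by
    rw [Set.image_singleton]
  refine ⟨fun i _ => ⟨mem_properCones.2 ⟨{i}, hne i, hs i⟩, ?_⟩, fun i _ j _ hij => ?_, ?_⟩
  · have h1 := h.finrank_span_hull (hne i)
    rwa [Set.image_singleton, Set.ncard_singleton] at h1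
  · have h1 : u i ∈ PointedCone.hull ℚ (u '' {j}) := by
      rw [← hs, ← show PointedCone.hull ℚ {u i} = PointedCone.hull ℚ {u j} from hij]
      exact PointedCone.subset_hull rfl
    exact (h.mem_hull_iff (hne j)).1 h1
  · rintro ρ ⟨hρ, hρ1⟩
    obtain ⟨I, hI, rfl⟩ := mem_properCones.1 hρ
    rw [h.finrank_span_hull hI, Set.ncard_eq_one] at hρ1
    obtain ⟨i, rfl⟩ := hρ1
    exact ⟨i, trivial, hs i⟩

end HasPositiveRelation

end Fan

/-! ### The stacky fan of a weighted projective stack -/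

section WeightedFan

theorem StackyFan.irrelevantIdeal_eq_originIdeal {N : Type} [AddCommGroup N] {m : ℕ}
    [Nontrivial (Fin m)] (F : StackyFan N m) {u : Fin m → ℚ ⊗[ℤ] N} {a : Fin m → ℚ}
    (h : HasPositiveRelation u a) (hu : ∀ i, (1 : ℚ) ⊗ₜ[ℤ] F.β (Pi.single i 1) = u i)
    (hF : F.cones = properCones u) : F.irrelevantIdeal = originIdeal m := by
  classical
  have hle : ∀ {I : Set (Fin m)}, I ≠ Set.univ → ∀ i,
      rayOf (F.β (Pi.single i 1)) ≤ PointedCone.hull ℚ (u '' I) ↔ i ∈ I := fun {I} hI i => by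
    rw [rayOf, hu, ← h.mem_hull_iff hI]
    exact Submodule.span_singleton_le_iff_mem _ _
  have hX : ∀ {I : Set (Fin m)}, I ≠ Set.univ →
      F.coxMonomial (PointedCone.hull ℚ (u '' I)) = ∏ i with i ∉ I, MvPolynomial.X i :=
    fun {I} hI => by
      rw [coxMonomial]
      exact Finset.prod_congr (by ext i; simp [hle hI]) fun _ _ => rfl
  refine le_antisymm (Ideal.span_le.2 ?_) (Ideal.span_le.2 ?_)
  · rintro _ ⟨σ, hσ, rfl⟩
    rw [hF] at hσ
    obtain ⟨I, hI, rfl⟩ := mem_properCones.1 hσ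
    obtain ⟨j, hj⟩ := (Set.ne_univ_iff_exists_notMem I).1 hI
    rw [hX hI]
    exact Ideal.mem_of_dvd _ (Finset.dvd_prod_of_mem _ (by simpa using hj))
      (Ideal.subset_span ⟨j, rfl⟩)
  · rintro _ ⟨i, rfl⟩
    -- The cone omitting only the `i`-th ray contributes the monomial `x_i`; every other proper
    -- subset contributes a multiple of some `x_j`.
    have hI : ({i}ᶜ : Set (Fin m)) ≠ Set.univ := by simp
    refine Ideal.subset_span ⟨_, hF ▸ mem_properCones.2 ⟨_, hI, rfl⟩, ?_⟩
    rw [hX hI]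
    simp [Finset.filter_eq']

variable {n d : ℕ} {a : Fin (n + 1) → ℕ} {v : Fin (n + 1) → (Fin n → ℤ)}
  {c : Fin (n + 1) → ZMod d}

theorem span_range_intCast (hv : Submodule.span ℤ (Set.range v) = ⊤) :
    Submodule.span ℚ (Set.range fun i j => (v i j : ℚ)) = ⊤ := by
  rw [eq_top_iff, ← (Pi.basisFun ℚ (Fin n)).span_eq, Submodule.span_le]
  rintro _ ⟨j, rfl⟩
  have h1 : (Pi.single j 1 : Fin n → ℤ) ∈ Submodule.span ℤ (Set.range v) := hv ▸ trivial
  obtain ⟨z, hz⟩ := (Submodule.mem_span_range_iff_exists_fun ℤ).1 h1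
  refine (Submodule.mem_span_range_iff_exists_fun ℚ).2 ⟨fun i => z i, ?_⟩
  ext k
  have h2 := congrArg (Int.cast : ℤ → ℚ) (congrFun hz k)
  simpa [Finset.sum_apply, Pi.single_apply] using h2

theorem hasPositiveRelation (ha0 : ∀ i, 0 < a i) (ha : Finset.univ.gcd a = 1) (hd : 0 < d)
    (hv : Submodule.span ℤ (Set.range v) = ⊤) (hav : ∑ i, (a i : ℤ) • v i = 0) :
    HasPositiveRelation (fun i => (1 : ℚ) ⊗ₜ[ℤ] ((v i, c i) : (Fin n → ℤ) × ZMod d))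
      fun i => (a i : ℚ) where
  pos i := Nat.cast_pos.2 (ha0 i)
  sum_eq_zero := by
    have h1 : ∑ i, (a i : ℚ) • (1 : ℚ) ⊗ₜ[ℤ] ((v i, c i) : (Fin n → ℤ) × ZMod d) =
        (1 : ℚ) ⊗ₜ[ℤ] ∑ i, (a i : ℤ) • ((v i, c i) : (Fin n → ℤ) × ZMod d) := by
      rw [TensorProduct.tmul_sum]
      refine Finset.sum_congr rfl fun i _ => ?_
      rw [← TensorProduct.smul_tmul, TensorProduct.smul_tmul']
      simp
    -- The relation holds in `N` only up to the torsion element `(0, ∑ a_i c_i)`; multiplying by `d`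
    -- kills it, and `d` is invertible in `ℚ`.
    have h2 : (d : ℤ) • ∑ i, (a i : ℤ) • ((v i, c i) : (Fin n → ℤ) × ZMod d) = 0 := by
      refine Prod.ext ?_ ?_
      · simp only [Prod.smul_fst, Prod.fst_sum, hav, smul_zero, Prod.fst_zero]
      · simp
    have h3 : (1 : ℚ) = (d : ℤ) • (d : ℚ)⁻¹ := by
      have : (d : ℚ) ≠ 0 := Nat.cast_ne_zero.2 hd.ne'
      simp [this]
    rw [h1, h3, TensorProduct.smul_tmul, h2, TensorProduct.tmul_zero]
  eq_smul x hx := by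
    -- Forgetting torsion and extending scalars moves the relation into `ℚ^n`.
    let f : (Fin n → ℤ) × ZMod d →ₗ[ℤ] (Fin n → ℚ) :=
      (LinearMap.compLeft (Int.castAddHom ℚ).toIntLinearMap (Fin n)) ∘ₗ LinearMap.fst ℤ _ _
    have h1 := congrArg (f.liftBaseChange ℚ) hx
    simp only [map_sum, map_smul, LinearMap.liftBaseChange_tmul, one_smul, map_zero] at h1
    obtain ⟨y, hy⟩ := exists_sum_mul_eq_one ha
    refine eq_smul_of_sum_smul_eq_zero (v := fun i j => (v i j : ℚ)) (y := fun i => (y i : ℚ))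
      (span_range_intCast hv) ?_ (by exact_mod_cast congrArg (Int.cast : ℤ → ℚ) hy) h1
    ext k
    have h2 := congrArg (Int.cast : ℤ → ℚ) (congrFun hav k)
    simpa [Finset.sum_apply] using h2

variable (v c) in
/-- The homomorphism `ℤ^{n+1} → ℤ^n ⊕ ℤ/d` with `e_i ↦ (v_i, c_i)`. -/
def latticeMap : (Fin (n + 1) → ℤ) →ₗ[ℤ] (Fin n → ℤ) × ZMod d :=
  Fintype.linearCombination ℤ fun i => (v i, c i)

theorem latticeMap_apply (x : Fin (n + 1) → ℤ) :
    latticeMap v c x = (∑ i, x i • v i, ∑ i, (x i : ZMod d) * c i) := by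
  rw [latticeMap, Fintype.linearCombination_apply]
  refine Prod.ext ?_ ?_
  · simp only [Prod.fst_sum, Prod.smul_fst]
  · simp only [Prod.snd_sum, Prod.smul_snd]
    simp

theorem latticeMap_single (i : Fin (n + 1)) : latticeMap v c (Pi.single i 1) = (v i, c i) := by
  simp [latticeMap]

theorem latticeMap_smul_relation (hav : ∑ i, (a i : ℤ) • v i = 0) (t : ℤ) :
    latticeMap v c (t • fun i => (a i : ℤ)) = (0, (t : ZMod d) * ∑ i, (a i : ZMod d) * c i) := by
  have h : latticeMap v c (fun i => (a i : ℤ)) = (0, ∑ i, (a i : ZMod d) * c i) := by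
    rw [latticeMap_apply, hav]
    simp
  rw [map_smul, h]
  simp

/-- Adding a multiple of `a` leaves the free part fixed and, by the unit hypothesis, adjusts the
torsion part arbitrarily. -/
theorem latticeMap_surjective (hv : Submodule.span ℤ (Set.range v) = ⊤)
    (hav : ∑ i, (a i : ℤ) • v i = 0) (hc : IsUnit (∑ i, (a i : ZMod d) * c i)) :
    Function.Surjective (latticeMap v c) := by
  rintro ⟨z, w⟩
  have hz : z ∈ Submodule.span ℤ (Set.range v) := hv ▸ trivial
  obtain ⟨x, rfl⟩ := (Submodule.mem_span_range_iff_exists_fun ℤ).1 hz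
  obtain ⟨s, hs⟩ := hc.dvd (a := w - (latticeMap v c x).2)
  obtain ⟨t, rfl⟩ := ZMod.intCast_surjective s
  refine ⟨x + t • fun i => (a i : ℤ), ?_⟩
  rw [map_add, latticeMap_smul_relation hav, mul_comm, ← hs]
  exact Prod.ext (by simp [latticeMap_apply]) (by simp)

theorem eq_smul_of_latticeMap_eq_zero (ha : Finset.univ.gcd a = 1)
    (hv : Submodule.span ℤ (Set.range v) = ⊤) (hav : ∑ i, (a i : ℤ) • v i = 0)
    (hc : IsUnit (∑ i, (a i : ZMod d) * c i)) {x : Fin (n + 1) → ℤ}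
    (hx : latticeMap v c x = 0) : ∃ t : ℤ, x = t • fun i => ((d * a i : ℕ) : ℤ) := by
  obtain ⟨y, hy⟩ := exists_sum_mul_eq_one ha
  obtain ⟨t, rfl⟩ := eq_smul_of_sum_smul_eq_zero hv hav hy
    ((congrArg Prod.fst (latticeMap_apply x)).symm.trans (congrArg Prod.fst hx))
  rw [latticeMap_smul_relation hav] at hx
  -- Cancelling the unit gives `d ∣ t`; this is where `a` becomes `q = d a`.
  have ht : (t : ZMod d) = 0 := (hc.mul_left_eq_zero).1 (congrArg Prod.snd hx)
  obtain ⟨s, rfl⟩ := (ZMod.intCast_zmod_eq_zero_iff_dvd _ _).1 ht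
  refine ⟨s, funext fun i => ?_⟩
  simp
  ring

variable (v c) in
/-- The stacky fan in `ℤ^n ⊕ ℤ/d` with the cones generated by the proper subsets of the
`b_i = (v_i, c_i)`. -/
def weightedFan (hn : 1 ≤ n) (ha0 : ∀ i, 0 < a i) (ha : Finset.univ.gcd a = 1) (hd : 0 < d)
    (hv : Submodule.span ℤ (Set.range v) = ⊤) (hav : ∑ i, (a i : ℤ) • v i = 0)
    (hc : IsUnit (∑ i, (a i : ZMod d) * c i)) : StackyFan ((Fin n → ℤ) × ZMod d) (n + 1) where
  finite_lattice := by
    have : NeZero d := ⟨hd.ne'⟩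
    infer_instance
  cones := properCones fun i => (1 : ℚ) ⊗ₜ[ℤ] ((v i, c i) : (Fin n → ℤ) × ZMod d)
  isSimplicialFan := (hasPositiveRelation ha0 ha hd hv hav).isSimplicialFan
  β := latticeMap v c
  finite_coker := by
    rw [LinearMap.range_eq_top.2 (latticeMap_surjective hv hav hc)]
    infer_instance
  rays := by
    have : Nontrivial (Fin (n + 1)) := Fin.nontrivial_iff_two_le.2 (by lia)
    simp only [rayOf, latticeMap_single]
    exact (hasPositiveRelation ha0 ha hd hv hav).bijOn_rays

theorem weightedFan_spec (hn : 1 ≤ n) (ha0 : ∀ i, 0 < a i) (ha : Finset.univ.gcd a = 1)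
    (hd : 0 < d) (hv : Submodule.span ℤ (Set.range v) = ⊤) (hav : ∑ i, (a i : ℤ) • v i = 0)
    (hc : IsUnit (∑ i, (a i : ZMod d) * c i)) {q : Fin (n + 1) → ℕ} (hq : ∀ i, d * a i = q i)
    (D : GaleData (weightedFan v c hn ha0 ha hd hv hav hc).β) :
    (∃ e : D.DG ≃ₗ[ℤ] ℤ, ∀ i, e (D.dual (LinearMap.proj i)) = (q i : ℤ)) ∧
      StackIso ((weightedFan v c hn ha0 ha hd hv hav hc).toricStack D)
        (weightedProjectiveStack q) := by
  have : Nontrivial (Fin (n + 1)) := Fin.nontrivial_iff_two_le.2 (by lia)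
  obtain rfl : (fun i => d * a i) = q := funext hq
  obtain ⟨e, he⟩ := D.exists_equiv_int (k := fun i => ((d * a i : ℕ) : ℤ))
    (latticeMap_surjective hv hav hc)
    (fun h => (Nat.mul_pos hd (ha0 0)).ne' (Int.natCast_eq_zero.1 (congrFun h 0)))
    (by
      have h := latticeMap_smul_relation (c := c) hav d
      rw [Int.cast_natCast, ZMod.natCast_self, zero_mul] at h
      rw [show (fun i => ((d * a i : ℕ) : ℤ)) = (d : ℤ) • fun i => (a i : ℤ) by ext; simp]
      exact h)
    fun x hx => eq_smul_of_latticeMap_eq_zero ha hv hav hc hx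
  refine ⟨⟨e, fun i => he _⟩, stackIso_diagQuotient e.toAddEquiv _ _ (fun i => he _) ?_ _ _⟩
  exact StackyFan.irrelevantIdeal_eq_originIdeal _ (hasPositiveRelation ha0 ha hd hv hav)
    (fun i => congrArg (fun b => (1 : ℚ) ⊗ₜ[ℤ] b) (latticeMap_single i)) rfl

end WeightedFan

end ToricDM

end

/-! ### The proposition, including the existence of `v` and `c`. -/

theorem mainTheorem4 (n : ℕ) (hn : 1 ≤ n) (q : Fin (n + 1) → ℕ) (hq : ∀ i, 0 < q i)
    (d : ℕ) (hd : d = Finset.univ.gcd q) :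
    (∃ (v : Fin (n + 1) → (Fin n → ℤ)) (c : Fin (n + 1) → ZMod d),
      Submodule.span ℤ (Set.range v) = ⊤ ∧ ∑ i, ((q i / d : ℕ) : ℤ) • v i = 0 ∧
      IsUnit (∑ i, ((q i / d : ℕ) : ZMod d) * c i)) ∧
    ∀ (v : Fin (n + 1) → (Fin n → ℤ)) (c : Fin (n + 1) → ZMod d),
      Submodule.span ℤ (Set.range v) = ⊤ → ∑ i, ((q i / d : ℕ) : ℤ) • v i = 0 →
      IsUnit (∑ i, ((q i / d : ℕ) : ZMod d) * c i) →
      ∃ F : StackyFan ((Fin n → ℤ) × ZMod d) (n + 1),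
        (∀ i, F.β (Pi.single i 1) = (v i, c i)) ∧
        F.cones = {σ | ∃ I : Finset (Fin (n + 1)), I ≠ Finset.univ ∧
          σ = PointedCone.hull ℚ
            ((fun i => (1 : ℚ) ⊗ₜ[ℤ] ((v i, c i) : (Fin n → ℤ) × ZMod d)) '' (I : Set (Fin (n + 1))))} ∧
        ∀ D : GaleData F.β,
          (∃ e : D.DG ≃ₗ[ℤ] ℤ, ∀ i, e (D.dual (LinearMap.proj i)) = (q i : ℤ)) ∧
          StackIso (F.toricStack D) (weightedProjectiveStack q) := by
  
  subst hd
  set d := Finset.univ.gcd q with hd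
  have hdvd : ∀ i, d ∣ q i := fun i => Finset.gcd_dvd (Finset.mem_univ i)
  have hd0 : 0 < d := Nat.pos_of_dvd_of_pos (hdvd 0) (hq 0)
  have ha0 : ∀ i, 0 < q i / d := fun i => Nat.div_pos (Nat.le_of_dvd (hq i) (hdvd i)) hd0
  have ha : Finset.univ.gcd (fun i => q i / d) = 1 :=
    Finset.gcd_div_eq_one (Finset.mem_univ 0) (hq 0).ne'
  refine ⟨?_, fun v c hv hav hc => ⟨weightedFan v c hn ha0 ha hd0 hv hav hc,
    latticeMap_single, rfl, weightedFan_spec hn ha0 ha hd0 hv hav hc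
      fun i => Nat.mul_div_cancel' (hdvd i)⟩⟩
  obtain ⟨y, hy⟩ := exists_sum_mul_eq_one ha
  obtain ⟨v, hv, hav⟩ := exists_generators_of_sum_mul_eq_one hy
  -- With `c` the Bézout coefficients modulo `d`, the sum `∑ a_i c_i` is equal to 1.
  refine ⟨v, fun i => (y i : ZMod d), hv, hav, IsUnit.of_mul_eq_one 1 ?_⟩
  have h := congrArg (Int.cast : ℤ → ZMod d) hy
  rw [Int.cast_sum, Int.cast_one] at h
  rw [_root_.mul_one, ← h]
  refine Finset.sum_congr rfl fun i _ => ?_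
  rw [Int.cast_mul, Int.cast_natCast, mul_comm]
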